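/- Let $n\ge 3$, and let the vertices of the complete graph $K_n$ be placed at $n$ regularly spaced points on a circle. The geometric realization of a subgraph of $K_n$ is the plane figure made up of the points of its vertices and the straight line segments joining the endpoints of its edges. Let $C_n$ be the set of the subgraphs of $K_n$ induced by Hamiltonian cycles, i.e. the subgraphs consisting of all vertices of $K_n$ and the edges traversed by the cycle. For $G_1,G_2\in C_n$ write $G_1\equiv_E G_2$ if some rotation about the center of the circle maps the geometric realization of $G_1$ onto that of $G_2$, and $G_1\equiv_S G_2$ if some rotation about the center, or some reflection in a line through the center, does so. Both are equivalence relations on $C_n$. Write $m!!$ for the product of all positive integers that are at most $m$ and have the same parity as $m$. **Corollary.** Let $p>2$ be a prime. Then $$|C_p/{\equiv_S}|=\frac{1}{4p}\left[(p-1)^2+p\,(p-1)!!+(p-1)!\right] \quad\text{and}\quad |C_p/{\equiv_E}|=\frac{1}{2p}\left[(p-1)^2+(p-1)!\right].$$ -/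

import Mathlib

open scoped Nat

namespace GeomHam

/-- The complete graph `K_n` on the labels `0, …, n - 1`. -/
abbrev K (n : ℕ) : SimpleGraph (Fin n) := ⊤

/-- The position of the vertex `k` of `K_n`: the `n` vertices are regularly spaced on the unit
circle of the plane `ℂ`. -/
noncomputable def point (n : ℕ) (k : Fin n) : ℂ :=
  Complex.exp (2 * Real.pi * Complex.I * ((k : ℕ) : ℂ) / (n : ℂ))

/-- The geometric realization of a subgraph of `K_n`: the plane figure consisting of the points of
its vertices and of the line segments that represent its edges. -/
noncomputable def figure {n : ℕ} (G : (K n).Subgraph) : Set ℂ :=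
  point n '' G.verts ∪ {z | ∃ u v : Fin n, G.Adj u v ∧ z ∈ segment ℝ (point n u) (point n v)}

/-- The subgraphs of `K_n` that are induced by Hamiltonian cycles. -/
def C (n : ℕ) : Set (K n).Subgraph :=
  {G | ∃ (v : Fin n) (w : (K n).Walk v v), w.IsHamiltonianCycle ∧ w.toSubgraph = G}

/-- The reflection of the plane that is `z ↦ a * conj z`, for `a` on the unit circle. These are
exactly the reflections in the lines through the center `0`. -/
noncomputable def reflection (a : Circle) : ℂ ≃ₗᵢ[ℝ] ℂ := Complex.conjLIE.trans (rotation a)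

/-- `G₁ ≡_E G₂`: the figure of `G₂` is the image of that of `G₁` under a rotation about the center
of the circle (`rotation a` is `z ↦ a * z`). -/
def Equivalent {n : ℕ} (G₁ G₂ : (K n).Subgraph) : Prop :=
  ∃ a : Circle, rotation a '' figure G₁ = figure G₂

/-- `G₁ ≡_S G₂`: the figure of `G₂` is the image of that of `G₁` under a rotation or a
reflection. -/
def Similar {n : ℕ} (G₁ G₂ : (K n).Subgraph) : Prop :=
  ∃ a : Circle, rotation a '' figure G₁ = figure G₂ ∨ reflection a '' figure G₁ = figure G₂

theorem reflection_apply (a : Circle) (z : ℂ) :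
    reflection a z = a * (starRingEnd ℂ) z := by
  simp [reflection, rotation_apply]

theorem rotation_rotation_image (a b : Circle) (s : Set ℂ) :
    rotation b '' (rotation a '' s) = rotation (b * a) '' s := by
  rw [Set.image_image]
  refine Set.image_congr fun z _ => ?_
  rw [rotation_apply, rotation_apply, rotation_apply, Circle.coe_mul, mul_assoc]

theorem rotation_inv_image (a : Circle) (s : Set ℂ) :
    rotation a⁻¹ '' (rotation a '' s) = s := by
  rw [rotation_rotation_image]
  simp

theorem reflection_reflection_image (a b : Circle) (s : Set ℂ) :
    reflection b '' (reflection a '' s) = rotation (b * a⁻¹) '' s := by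
  rw [Set.image_image]
  refine Set.image_congr fun z _ => ?_
  rw [reflection_apply, reflection_apply, rotation_apply, map_mul, Complex.conj_conj,
    Circle.coe_mul, Circle.coe_inv_eq_conj, mul_assoc]

theorem reflection_image_image (a : Circle) (s : Set ℂ) :
    reflection a '' (reflection a '' s) = s := by
  rw [reflection_reflection_image]
  simp

theorem reflection_rotation_image (a b : Circle) (s : Set ℂ) :
    reflection b '' (rotation a '' s) = reflection (b * a⁻¹) '' s := by
  rw [Set.image_image]
  refine Set.image_congr fun z _ => ?_
  rw [reflection_apply, reflection_apply, rotation_apply, map_mul,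
    Circle.coe_mul, Circle.coe_inv_eq_conj, mul_assoc]

theorem rotation_reflection_image (a b : Circle) (s : Set ℂ) :
    rotation b '' (reflection a '' s) = reflection (b * a) '' s := by
  rw [Set.image_image]
  refine Set.image_congr fun z _ => ?_
  rw [reflection_apply, reflection_apply, rotation_apply, Circle.coe_mul, mul_assoc]

theorem equivalent_equivalence (n : ℕ) : Equivalence (Equivalent (n := n)) where
  refl G := ⟨1, by simp⟩
  symm := by
    rintro G H ⟨a, h⟩
    exact ⟨a⁻¹, by rw [← h, rotation_inv_image]⟩
  trans := by
    rintro G H J ⟨a, h⟩ ⟨b, h'⟩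
    exact ⟨b * a, by rw [← h', ← h, rotation_rotation_image]⟩

theorem similar_equivalence (n : ℕ) : Equivalence (Similar (n := n)) where
  refl G := ⟨1, Or.inl (by simp)⟩
  symm := by
    rintro G H ⟨a, h | h⟩
    · exact ⟨a⁻¹, Or.inl (by rw [← h, rotation_inv_image])⟩
    · exact ⟨a, Or.inr (by rw [← h, reflection_image_image])⟩
  trans := by
    rintro G H J ⟨a, h | h⟩ ⟨b, h' | h'⟩
    · exact ⟨b * a, Or.inl (by rw [← h', ← h, rotation_rotation_image])⟩
    · exact ⟨b * a⁻¹, Or.inr (by rw [← h', ← h, reflection_rotation_image])⟩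
    · exact ⟨b * a, Or.inr (by rw [← h', ← h, rotation_reflection_image])⟩
    · exact ⟨b * a⁻¹, Or.inl (by rw [← h', ← h, reflection_reflection_image])⟩

/-- The equivalence relation `≡_E` on `C n`. -/
def relE (n : ℕ) : Setoid (C n) where
  r G H := Equivalent G.1 H.1
  iseqv := (equivalent_equivalence n).comap Subtype.val

/-- The equivalence relation `≡_S` on `C n`. -/
def relS (n : ℕ) : Setoid (C n) where
  r G H := Similar G.1 H.1
  iseqv := (similar_equivalence n).comap Subtype.val

end GeomHam

/-!
A Hamiltonian cycle on the vertices of the regular `n`-gon, `n ≥ 3`, is a cyclic order of the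
vertices. With the vertices labelled by `ZMod n`, it is given by a permutation `f` of `ZMod n`, and
its figure is the closed polygon `polygon f` through the vertices `f 0, f 1, …, f (n - 1)`.

Let `D` be the dihedral group, acting on `ZMod n` by the maps `x ↦ x + k` and `x ↦ -x - k`.

* Two permutations give the same polygon exactly if they differ by an element of `D` on the right
  (`polygon_eq_iff`). Two distinct chords of a circle share at most one point, so the figure
  determines its sides; and a permutation that preserves neighbours is dihedral.
* A polygon meets the circle in the vertices of the `n`-gon only. So a rotation or reflection that
  maps a polygon to a polygon permutes the vertices, and acts on `f` by an element of `D` on the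
  left (`exists_rotation_polygon_eq_iff`, `exists_reflection_polygon_eq_iff`).

Hence the classes of `≡_S` are the double cosets of `D` on both sides in the symmetric group, and
those of `≡_E` are the double cosets of the rotation subgroup `R` on the left and `D` on the right.
By Burnside's lemma their number, times the product of the orders of the two groups, is the sum over
pairs `(a, b)` of the number of permutations `x` with `a * x = x * b`
(`card_quotient_mul_card_mul_card`). That number is the order of the centralizer of `a` if `a` and
`b` are conjugate, and `0` otherwise.

For an odd prime `p` the elements of `D` have only three cycle types: the identity, with centralizer
of order `p!`; the `p - 1` nontrivial rotations, which are `p`-cycles with centralizer of order `p`;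
and the `p` reflections, products of `m = (p - 1) / 2` disjoint transpositions, with centralizer of
order `2 ^ m * m! = (p - 1)‼`. The sum is therefore `p! + (p - 1)² p` for the pair `R, D`, and
`p! + (p - 1)² p + p² (p - 1)‼` for the pair `D, D`; the products of the group orders are `2 p²` and
`4 p²`.
-/

open scoped Nat

namespace GeomHam

/-! ### Counting double cosets -/

/-- The solutions `x` of `a * x = x * b` are the elements conjugating `b` into `a`: a coset of the
centralizer of `a` if there is one, and none otherwise. -/
theorem card_intertwiners {X : Type*} [Group X] (a b : X) [Decidable (IsConj a b)] :
    Nat.card {x : X // a * x = x * b} =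
      if IsConj a b then Nat.card (Subgroup.centralizer {a}) else 0 := by
  split_ifs with h
  · obtain ⟨c, hc⟩ := isConj_iff.1 h
    have hc' : c * a = b * c := by rw [← hc]; group
    refine Nat.card_congr
      { toFun := fun x => ⟨x.1 * c, ?_⟩
        invFun := fun y => ⟨y.1 * c⁻¹, ?_⟩
        left_inv := fun x => by simp
        right_inv := fun y => by simp }
    · rw [Subgroup.mem_centralizer_singleton_iff, mul_assoc, hc', ← mul_assoc, ← mul_assoc, x.2]
    · have hy := Subgroup.mem_centralizer_singleton_iff.1 y.2
      rw [← mul_assoc, ← hy, ← hc]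
      group
  · have : IsEmpty {x : X // a * x = x * b} :=
      ⟨fun x => h (isConj_iff.2 ⟨x.1⁻¹, by rw [inv_inv, mul_assoc, x.2]; group⟩)⟩
    exact Nat.card_of_isEmpty

/-- The action of `G × H` on a group `X` by multiplication on the left through `l` and on the right
through `r`. Its orbits are the double cosets of the ranges of `l` and `r`. -/
@[reducible]
def doubleCosetAction {G H X : Type*} [Group G] [Group H] [Group X] (l : G →* X) (r : H →* X) :
    MulAction (G × H) X where
  smul c x := l c.1 * x * (r c.2)⁻¹
  one_smul x := by
    change l 1 * x * (r 1)⁻¹ = x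
    simp
  mul_smul c d x := by
    change l (c.1 * d.1) * x * (r (c.2 * d.2))⁻¹ = l c.1 * (l d.1 * x * (r d.2)⁻¹) * (r c.2)⁻¹
    simp only [map_mul]
    group

/-- Burnside's lemma for the classes of a relation `s` that `q` identifies with the double cosets
of the ranges of `l` and `r`. -/
theorem card_quotient_mul_card_mul_card {G H X β : Type*} [Group G] [Group H] [Group X]
    [Fintype G] [Fintype H] [Finite X] (l : G →* X) (r : H →* X) (s : Setoid β) (q : X → β)
    (hq : ∀ y, ∃ x, s (q x) y) (hs : ∀ x y, s (q x) (q y) ↔ ∃ a b, y = l a * x * r b) :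
    Nat.card (Quotient s) * (Fintype.card G * Fintype.card H) =
      ∑ a : G, ∑ b : H, Nat.card {x : X // l a * x = x * r b} := by
  classical
  have := Fintype.ofFinite X
  let := doubleCosetAction l r
  have smul_def (c : G × H) (x : X) : c • x = l c.1 * x * (r c.2)⁻¹ := rfl
  have horb (x y : X) : s (q x) (q y) ↔ MulAction.orbitRel (G × H) X x y := by
    rw [hs, MulAction.orbitRel_apply, MulAction.mem_orbit_symm, MulAction.mem_orbit_iff]
    constructor
    · rintro ⟨a, b, rfl⟩
      exact ⟨(a, b⁻¹), by simp [smul_def]⟩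
    · rintro ⟨⟨a, b⟩, rfl⟩
      exact ⟨a, b⁻¹, by simp [smul_def]⟩
  have e : Nat.card (Quotient (MulAction.orbitRel (G × H) X)) = Nat.card (Quotient s) := by
    refine Nat.card_eq_of_bijective
      (Quotient.map' (s₂ := s) q fun x y h => (horb x y).2 h) ⟨?_, ?_⟩
    · rintro ⟨x⟩ ⟨y⟩ h
      exact Quotient.sound ((horb x y).1 (Quotient.exact h))
    · rintro ⟨y⟩
      obtain ⟨x, hx⟩ := hq y
      exact ⟨Quotient.mk _ x, Quotient.sound hx⟩
  have key := MulAction.sum_card_fixedBy_eq_card_orbits_mul_card_group (G × H) X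
  rw [Fintype.card_prod, ← Nat.card_eq_fintype_card (α := Quotient _), e] at key
  rw [← key, Fintype.sum_prod_type]
  refine Finset.sum_congr rfl fun a _ => Finset.sum_congr rfl fun b _ => ?_
  rw [← Nat.card_eq_fintype_card]
  refine Nat.card_congr (Equiv.subtypeEquivRight fun x => ?_)
  rw [MulAction.mem_fixedBy, smul_def, mul_inv_eq_iff_eq_mul]

/-! ### The dihedral group as permutations of `ZMod n` -/

/-- The action of the dihedral group on the labels `ZMod n` of the vertices of the regular `n`-gon:
`r k` acts as `x ↦ x + k` and `sr k` as `x ↦ -x - k`. -/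
def dihedralPerm (n : ℕ) : DihedralGroup n →* Equiv.Perm (ZMod n) where
  toFun
    | .r k => Equiv.addRight k
    | .sr k => (Equiv.neg _).trans (Equiv.addRight (-k))
  map_one' := by
    change Equiv.addRight (0 : ZMod n) = 1
    ext x
    simp
  map_mul' := by
    rintro (a | a) (b | b) <;> ext x <;> simp <;> ring

@[simp]
theorem dihedralPerm_r {n : ℕ} (k x : ZMod n) : dihedralPerm n (.r k) x = x + k := rfl

@[simp]
theorem dihedralPerm_sr {n : ℕ} (k x : ZMod n) : dihedralPerm n (.sr k) x = -x - k :=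
  (sub_eq_add_neg _ _).symm

/-- The subgroup of rotations, as a homomorphism into the dihedral group. -/
def rotationHom (n : ℕ) : Multiplicative (ZMod n) →* DihedralGroup n where
  toFun k := .r k.toAdd
  map_one' := rfl
  map_mul' _ _ := rfl

theorem sum_dihedralGroup {n : ℕ} [NeZero n] (F : DihedralGroup n → ℕ) :
    ∑ a, F a = ∑ k, F (.r k) + ∑ k, F (.sr k) := by
  let e : ZMod n ⊕ ZMod n → DihedralGroup n := Sum.elim .r .sr
  have he : e.Bijective := by
    constructor
    · rintro (a | a) (b | b) h <;> simp [e] at h ⊢ <;> exact h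
    · rintro (a | a)
      exacts [⟨.inl a, rfl⟩, ⟨.inr a, rfl⟩]
  rw [← Function.Bijective.sum_comp he, Fintype.sum_sum_type]
  rfl

/-! ### Cycle types and centralizers of rotations and reflections -/

section CycleType

variable {p : ℕ} [Fact p.Prime]

/-- A nontrivial rotation of the `p`-gon, `p` prime, has order `p` and no fixed points. -/
theorem cycleType_dihedralPerm_r {k : ZMod p} (hk : k ≠ 0) :
    (dihedralPerm p (.r k)).cycleType = {p} := by
  have hpow : ∀ m : ℕ, ∀ x, (dihedralPerm p (.r k) ^ m) x = x + m * k := by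
    intro m
    induction m with
    | zero => simp
    | succ m ih =>
      intro x
      rw [pow_succ', Equiv.Perm.mul_apply, ih, dihedralPerm_r]
      push_cast
      ring
  have hord : orderOf (dihedralPerm p (.r k)) = p := by
    refine orderOf_eq_prime (Equiv.ext fun x => by simp [hpow]) fun h => hk ?_
    simpa using DFunLike.congr_fun h 0
  obtain ⟨m, hm⟩ := Equiv.Perm.cycleType_prime_order
    (σ := dihedralPerm p (.r k)) (by rw [hord]; exact Fact.out)
  have hsupp : (dihedralPerm p (.r k)).support = Finset.univ := by
    ext x
    simp [hk]
  have hsum := (dihedralPerm p (.r k)).sum_cycleType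
  rw [hm, hsupp, hord, Finset.card_univ, ZMod.card, Multiset.sum_replicate, smul_eq_mul] at hsum
  have : m = 0 := by
    have := Nat.eq_of_mul_eq_mul_right (Fact.out : p.Prime).pos (hsum.trans (one_mul p).symm)
    omega
  rw [hm, hord, this]
  rfl

/-- A reflection of the `p`-gon, `p` an odd prime, is an involution with a single fixed point. -/
theorem cycleType_dihedralPerm_sr {m : ℕ} (hp : p = 2 * m + 1) (hm : 0 < m) (k : ZMod p) :
    (dihedralPerm p (.sr k)).cycleType = Multiset.replicate m 2 := by
  have h2 : (2 : ZMod p) ≠ 0 := by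
    intro h
    have := (ZMod.natCast_eq_zero_iff 2 p).1 (by exact_mod_cast h)
    have := Nat.le_of_dvd two_pos this
    omega
  have hfix : ∀ x, dihedralPerm p (.sr k) x = x ↔ x = -k / 2 := by
    intro x
    rw [dihedralPerm_sr, eq_div_iff h2]
    constructor <;> intro h <;> linear_combination -h
  have hord : orderOf (dihedralPerm p (.sr k)) = 2 := by
    refine orderOf_eq_prime (Equiv.ext fun x => by simp [pow_two]) fun h => ?_
    have h0 := (hfix (-k / 2 + 1)).1 (by rw [h]; rfl)
    simp at h0
  obtain ⟨l, hl⟩ :=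
    Equiv.Perm.cycleType_prime_order
    (σ := dihedralPerm p (.sr k)) (by rw [hord]; exact Nat.prime_two)
  have hsupp : (dihedralPerm p (.sr k)).support = Finset.univ.erase (-k / 2) := by
    ext x
    simp [-dihedralPerm_sr, hfix]
  have hsum := (dihedralPerm p (.sr k)).sum_cycleType
  rw [hl, hsupp, hord, Finset.card_erase_of_mem (Finset.mem_univ _), Finset.card_univ, ZMod.card,
    Multiset.sum_replicate, smul_eq_mul] at hsum
  rw [hl, hord, show l + 1 = m by omega]

/-- The number of permutations `x` with `ρ a * x = x * ρ b`, for `ρ` the dihedral action. -/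
noncomputable def numIntertwiners (n : ℕ) (a b : DihedralGroup n) : ℕ :=
  Nat.card {x : Equiv.Perm (ZMod n) // dihedralPerm n a * x = x * dihedralPerm n b}

theorem numIntertwiners_eq (a b : DihedralGroup p) :
    numIntertwiners p a b =
      if (dihedralPerm p a).cycleType = (dihedralPerm p b).cycleType then
        (p - (dihedralPerm p a).cycleType.sum)! * (dihedralPerm p a).cycleType.prod *
          ∏ n ∈ (dihedralPerm p a).cycleType.toFinset, ((dihedralPerm p a).cycleType.count n)!
      else 0 := by
  classical
  rw [numIntertwiners, card_intertwiners, Equiv.Perm.nat_card_centralizer, ZMod.card]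
  simp only [Equiv.Perm.isConj_iff_cycleType_eq]

theorem sum_numIntertwiners_r_r :
    ∑ i, ∑ j, numIntertwiners p (.r i) (.r j) = p ! + (p - 1) * ((p - 1) * p) := by
  classical
  have h : ∀ i j : ZMod p, numIntertwiners p (.r i) (.r j) =
      if i = 0 then (if j = 0 then p ! else 0) else (if j = 0 then 0 else p) := by
    intro i j
    rw [numIntertwiners_eq]
    by_cases hi : i = 0 <;> by_cases hj : j = 0
    · simp [hi, hj]
    · simp [hi, hj, cycleType_dihedralPerm_r]
    · simp [hi, hj, cycleType_dihedralPerm_r]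
    · simp [hi, hj, cycleType_dihedralPerm_r]
  have hcard : ∀ c : ℕ, ∑ j : ZMod p, (if j = 0 then 0 else c) = (p - 1) * c := by
    intro c
    rw [Finset.sum_ite, Finset.sum_const_zero, zero_add, Finset.sum_const, smul_eq_mul,
      Finset.filter_ne', Finset.card_erase_of_mem (Finset.mem_univ _), Finset.card_univ, ZMod.card]
  have hrow : ∀ i : ZMod p, ∑ j, numIntertwiners p (.r i) (.r j) =
      (if i = 0 then p ! else 0) + (if i = 0 then 0 else (p - 1) * p) := by
    intro i
    simp only [h]
    split_ifs with hi
    · simp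
    · rw [hcard, zero_add]
  simp only [hrow, Finset.sum_add_distrib, hcard]
  simp

theorem numIntertwiners_sr_sr {m : ℕ} (hp : p = 2 * m + 1) (hm : 0 < m) (i j : ZMod p) :
    numIntertwiners p (.sr i) (.sr j) = (p - 1)‼ := by
  rw [numIntertwiners_eq, cycleType_dihedralPerm_sr hp hm, cycleType_dihedralPerm_sr hp hm,
    if_pos rfl, Multiset.toFinset_replicate, if_neg hm.ne', Finset.prod_singleton,
    Multiset.count_replicate_self, Multiset.sum_replicate, Multiset.prod_replicate,
    show p - m • 2 = 1 by rw [smul_eq_mul]; omega, show p - 1 = 2 * m by omega,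
    Nat.doubleFactorial_two_mul, Nat.factorial_one, one_mul]

/-- Rotations and reflections of the `p`-gon, `p` an odd prime, are not conjugate as
permutations: `2` occurs in the cycle type of the reflections only. -/
theorem cycleType_dihedralPerm_r_ne_sr {m : ℕ} (hp : p = 2 * m + 1) (hm : 0 < m) (i j : ZMod p) :
    (dihedralPerm p (.r i)).cycleType ≠ (dihedralPerm p (.sr j)).cycleType := by
  rw [cycleType_dihedralPerm_sr hp hm]
  intro h
  have h2 : 2 ∈ (dihedralPerm p (.r i)).cycleType := by
    rw [h]
    exact Multiset.mem_replicate.2 ⟨hm.ne', rfl⟩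
  by_cases hi : i = 0
  · rw [hi, ← DihedralGroup.one_def, map_one, Equiv.Perm.cycleType_one] at h2
    exact Multiset.notMem_zero _ h2
  · rw [cycleType_dihedralPerm_r hi, Multiset.mem_singleton] at h2
    omega

theorem numIntertwiners_r_sr {m : ℕ} (hp : p = 2 * m + 1) (hm : 0 < m) (i j : ZMod p) :
    numIntertwiners p (.r i) (.sr j) = 0 := by
  rw [numIntertwiners_eq, if_neg (cycleType_dihedralPerm_r_ne_sr hp hm i j)]

theorem numIntertwiners_sr_r {m : ℕ} (hp : p = 2 * m + 1) (hm : 0 < m) (i j : ZMod p) :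
    numIntertwiners p (.sr i) (.r j) = 0 := by
  rw [numIntertwiners_eq, if_neg (cycleType_dihedralPerm_r_ne_sr hp hm j i).symm]

theorem sum_numIntertwiners_rotation {m : ℕ} (hp : p = 2 * m + 1) (hm : 0 < m) :
    ∑ i, ∑ b, numIntertwiners p (.r i) b = p ! + (p - 1) * ((p - 1) * p) := by
  simp only [sum_dihedralGroup, numIntertwiners_r_sr hp hm, Finset.sum_const_zero, add_zero]
  exact sum_numIntertwiners_r_r

theorem sum_numIntertwiners {m : ℕ} (hp : p = 2 * m + 1) (hm : 0 < m) :
    ∑ a, ∑ b, numIntertwiners p a b = p ! + (p - 1) * ((p - 1) * p) + p * (p * (p - 1)‼) := by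
  rw [sum_dihedralGroup, sum_numIntertwiners_rotation hp hm]
  simp [sum_dihedralGroup, numIntertwiners_sr_r hp hm, numIntertwiners_sr_sr hp hm, ZMod.card]

end CycleType

/-! ### Chords of the unit circle -/

/-- The equation of the line through the points `u` and `v` of the unit circle. -/
theorem chord_equation {u v : Circle} {z : ℂ} (hz : z ∈ segment ℝ (u : ℂ) v) :
    z + u * v * (starRingEnd ℂ) z = u + v := by
  obtain ⟨a, b, -, -, hab, rfl⟩ := hz
  have hu : (u : ℂ) * (starRingEnd ℂ) u = 1 := by simp [Complex.mul_conj]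
  have hv : (v : ℂ) * (starRingEnd ℂ) v = 1 := by simp [Complex.mul_conj]
  have hab' : (a : ℂ) + b = 1 := by exact_mod_cast hab
  simp only [Complex.real_smul, map_add, map_mul, Complex.conj_ofReal]
  linear_combination (a * v : ℂ) * hu + (b * u : ℂ) * hv + (u + v : ℂ) * hab'

/-- A chord meets the circle in its endpoints only. -/
theorem eq_or_eq_of_mem_chord {u v a : Circle} (h : (a : ℂ) ∈ segment ℝ (u : ℂ) v) :
    a = u ∨ a = v := by
  have h1 := chord_equation h
  have ha : (a : ℂ) * (starRingEnd ℂ) a = 1 := by simp [Complex.mul_conj]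
  have h2 : ((a : ℂ) - u) * (a - v) = 0 := by
    linear_combination (a : ℂ) * h1 - (u * v : ℂ) * ha
  rcases mul_eq_zero.1 h2 with h | h
  · exact Or.inl (Circle.ext (sub_eq_zero.1 h))
  · exact Or.inr (Circle.ext (sub_eq_zero.1 h))

/-- Two different chords have at most one point in common. -/
theorem chord_inter_subsingleton {u v u' v' : Circle}
    (h : ¬((u = u' ∧ v = v') ∨ (u = v' ∧ v = u'))) :
    (segment ℝ (u : ℂ) v ∩ segment ℝ (u' : ℂ) v').Subsingleton := by
  rintro z ⟨hz, hz'⟩ w ⟨hw, hw'⟩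
  have ez := chord_equation hz
  have ez' := chord_equation hz'
  have ew := chord_equation hw
  have ew' := chord_equation hw'
  have key : ((u : ℂ) * v - u' * v') * ((starRingEnd ℂ) z - (starRingEnd ℂ) w) = 0 := by
    linear_combination ez - ez' - ew + ew'
  rcases mul_eq_zero.1 key with hp | hc
  · -- The endpoints have the same product, hence the same sum, so they agree up to order.
    refine absurd ?_ h
    have hsum : (u : ℂ) + v = u' + v' := by
      linear_combination ez' - ez + (starRingEnd ℂ) z * hp
    have hroot : ((u : ℂ) - u') * (u - v') = 0 := by
      linear_combination (u : ℂ) * hsum - hp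
    rcases mul_eq_zero.1 hroot with e | e
    · exact Or.inl ⟨Circle.ext (sub_eq_zero.1 e), Circle.ext (by linear_combination hsum - e)⟩
    · exact Or.inr ⟨Circle.ext (sub_eq_zero.1 e), Circle.ext (by linear_combination hsum - e)⟩
  · exact (starRingEnd ℂ).injective (sub_eq_zero.1 hc)

theorem segment_infinite {x y : ℂ} (h : x ≠ y) : (segment ℝ x y).Infinite := by
  rw [segment_eq_image_lineMap]
  exact (Set.Icc_infinite zero_lt_one).image (AffineMap.lineMap_injective ℝ h).injOn

/-! ### Closed polygons through the vertices of the regular `n`-gon -/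

/-- The closed polygon that visits the vertices of the regular `n`-gon, labelled by `ZMod n`, in
the order `f 0, f 1, …, f (n - 1), f 0`. -/
def polygon {n : ℕ} [NeZero n] (f : Equiv.Perm (ZMod n)) : Set ℂ :=
  ⋃ i, segment ℝ (ZMod.toCircle (f i) : ℂ) (ZMod.toCircle (f (i + 1)))

section Polygon

variable {n : ℕ} [NeZero n]

theorem toCircle_mem_polygon (f : Equiv.Perm (ZMod n)) (x : ZMod n) :
    (ZMod.toCircle x : ℂ) ∈ polygon f := by
  refine Set.mem_iUnion.2 ⟨f.symm x, ?_⟩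
  rw [Equiv.apply_symm_apply]
  exact left_mem_segment _ _ _

theorem exists_eq_toCircle_of_mem_polygon {f : Equiv.Perm (ZMod n)} {a : Circle}
    (h : (a : ℂ) ∈ polygon f) : ∃ x : ZMod n, a = ZMod.toCircle x := by
  obtain ⟨i, hi⟩ := Set.mem_iUnion.1 h
  rcases eq_or_eq_of_mem_chord hi with h | h
  exacts [⟨_, h⟩, ⟨_, h⟩]

theorem rotation_polygon (f : Equiv.Perm (ZMod n)) (k : ZMod n) :
    rotation (ZMod.toCircle k) '' polygon f = polygon (dihedralPerm n (.r k) * f) := by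
  have h (x y : ℂ) : rotation (ZMod.toCircle k) '' segment ℝ x y =
      segment ℝ (ZMod.toCircle k * x) (ZMod.toCircle k * y) := by
    have := image_segment ℝ (rotation (ZMod.toCircle k)).toLinearMap.toAffineMap x y
    simpa using this
  simp only [polygon, Set.image_iUnion, h, Equiv.Perm.mul_apply, dihedralPerm_r,
    AddChar.map_add_eq_mul, Circle.coe_mul, mul_comm]

theorem reflection_polygon (f : Equiv.Perm (ZMod n)) (k : ZMod n) :
    reflection (ZMod.toCircle (-k)) '' polygon f = polygon (dihedralPerm n (.sr k) * f) := by
  have h (x y : ℂ) : reflection (ZMod.toCircle (-k)) '' segment ℝ x y =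
      segment ℝ (ZMod.toCircle (-k) * (starRingEnd ℂ) x)
        (ZMod.toCircle (-k) * (starRingEnd ℂ) y) := by
    have := image_segment ℝ (reflection (ZMod.toCircle (-k))).toLinearMap.toAffineMap x y
    simpa [reflection_apply] using this
  have hneg (x : ZMod n) : (starRingEnd ℂ) (ZMod.toCircle x : ℂ) = ZMod.toCircle (-x) := by
    rw [AddChar.map_neg_eq_inv, Circle.coe_inv_eq_conj]
  simp only [polygon, Set.image_iUnion, h, Equiv.Perm.mul_apply, dihedralPerm_sr, hneg,
    sub_eq_add_neg, AddChar.map_add_eq_mul, Circle.coe_mul, mul_comm]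

theorem polygon_mul_dihedralPerm (f : Equiv.Perm (ZMod n)) (d : DihedralGroup n) :
    polygon (f * dihedralPerm n d) = polygon f := by
  rcases d with k | k
  · refine Set.iUnion_congr_of_surjective _ (Equiv.addRight k).surjective fun i => ?_
    simp [add_right_comm]
  · refine Set.iUnion_congr_of_surjective _
      ((Equiv.neg _).trans (Equiv.addRight (-k - 1))).surjective fun i => ?_
    rw [segment_symm]
    simp only [Equiv.trans_apply, Equiv.neg_apply, Equiv.coe_addRight, Equiv.Perm.mul_apply,
      dihedralPerm_sr]
    rw [show -i + (-k - 1) + 1 = -i - k by ring, show -i + (-k - 1) = -(i + 1) - k by ring]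

/-- A permutation of `ZMod n` that takes neighbours to neighbours is dihedral. -/
theorem eq_dihedralPerm_of_neighbours (hn : 3 ≤ n) (h : Equiv.Perm (ZMod n))
    (hh : ∀ i, h (i + 1) = h i + 1 ∨ h (i + 1) = h i - 1) : ∃ d, h = dihedralPerm n d := by
  have h2 : (2 : ZMod n) ≠ 0 := by
    intro h
    have := Nat.le_of_dvd two_pos ((ZMod.natCast_eq_zero_iff 2 n).1 (by exact_mod_cast h))
    omega
  -- A step cannot undo the one before it, as `h` is injective: all steps are equal.
  have step (i : ZMod n) : h (i + 1 + 1) - h (i + 1) = h (i + 1) - h i := by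
    have hne : h (i + 1 + 1) ≠ h i := by
      intro e
      have := h.injective e
      exact h2 (by linear_combination this)
    rcases hh i with h1 | h1 <;> rcases hh (i + 1) with h3 | h3
    · rw [h3, h1]; ring
    · exact absurd (by rw [h3, h1]; ring) hne
    · exact absurd (by rw [h3, h1]; ring) hne
    · rw [h3, h1]; ring
  have hstep (m : ℕ) : h ((m : ZMod n) + 1) - h m = h 1 - h 0 := by
    induction m with
    | zero => simp
    | succ m ih => rw [← ih, Nat.cast_succ, step]
  have hlin (m : ℕ) : h (m : ZMod n) = h 0 + m * (h 1 - h 0) := by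
    induction m with
    | zero => simp
    | succ m ih =>
      rw [Nat.cast_succ]
      linear_combination hstep m + ih
  have hlin' (x : ZMod n) : h x = h 0 + x * (h 1 - h 0) := by
    simpa using hlin x.val
  rcases hh 0 with h1 | h1 <;> rw [zero_add] at h1
  · exact ⟨.r (h 0), Equiv.ext fun x => by rw [hlin', h1, dihedralPerm_r]; ring⟩
  · exact ⟨.sr (-h 0), Equiv.ext fun x => by rw [hlin', h1, dihedralPerm_sr]; ring⟩

/-- A side of a polygon contained in another polygon is a side of the latter: otherwise the other
polygon's finitely many sides would meet it in finitely many points. -/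
theorem exists_side_eq (hn : 3 ≤ n) {f g : Equiv.Perm (ZMod n)} (h : polygon g ⊆ polygon f)
    (i : ZMod n) :
    ∃ j, (g i = f j ∧ g (i + 1) = f (j + 1)) ∨ (g i = f (j + 1) ∧ g (i + 1) = f j) := by
  have : Fact (1 < n) := ⟨by omega⟩
  by_contra! hne
  have hinf : (segment ℝ (ZMod.toCircle (g i) : ℂ) (ZMod.toCircle (g (i + 1)))).Infinite := by
    refine segment_infinite fun e => ?_
    have := g.injective (ZMod.injective_toCircle (Circle.ext e))
    simp at this
  refine hinf (Set.Finite.subset (Set.finite_iUnion fun j =>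
    (chord_inter_subsingleton (u := ZMod.toCircle (g i)) (v := ZMod.toCircle (g (i + 1)))
      (u' := ZMod.toCircle (f j)) (v' := ZMod.toCircle (f (j + 1))) ?_).finite) ?_)
  · simp only [ZMod.injective_toCircle.eq_iff]
    rintro (⟨h1, h2⟩ | ⟨h1, h2⟩)
    · exact (hne j).1 h1 h2
    · exact (hne j).2 h1 h2
  · rw [← Set.inter_iUnion]
    exact Set.subset_inter subset_rfl ((Set.subset_iUnion_of_subset i subset_rfl).trans h)

theorem polygon_eq_iff (hn : 3 ≤ n) (f g : Equiv.Perm (ZMod n)) :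
    polygon f = polygon g ↔ ∃ d, g = f * dihedralPerm n d := by
  constructor
  · intro h
    obtain ⟨d, hd⟩ := eq_dihedralPerm_of_neighbours hn (f⁻¹ * g) fun i => by
      obtain ⟨j, ⟨h1, h2⟩ | ⟨h1, h2⟩⟩ := exists_side_eq hn h.ge i
      · left; simp [h1, h2]
      · right; simp [h1, h2]
    exact ⟨d, by rw [← hd, mul_inv_cancel_left]⟩
  · rintro ⟨d, rfl⟩
    exact (polygon_mul_dihedralPerm f d).symm

/-- A rotation or reflection that maps a polygon to a polygon permutes the vertices. -/
theorem exists_rotation_polygon_eq_iff (hn : 3 ≤ n) (f g : Equiv.Perm (ZMod n)) :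
    (∃ a, rotation a '' polygon f = polygon g) ↔
      ∃ k d, g = dihedralPerm n (.r k) * f * dihedralPerm n d := by
  constructor
  · rintro ⟨a, h⟩
    have ha : (a : ℂ) ∈ polygon g := by
      rw [← h]
      exact ⟨1, by simpa using toCircle_mem_polygon f 0, by simp [rotation_apply]⟩
    obtain ⟨k, rfl⟩ := exists_eq_toCircle_of_mem_polygon ha
    rw [rotation_polygon, polygon_eq_iff hn] at h
    exact ⟨k, h⟩
  · rintro ⟨k, d, h⟩
    exact ⟨ZMod.toCircle k, by rw [rotation_polygon, polygon_eq_iff hn]; exact ⟨d, h⟩⟩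

theorem exists_reflection_polygon_eq_iff (hn : 3 ≤ n) (f g : Equiv.Perm (ZMod n)) :
    (∃ a, reflection a '' polygon f = polygon g) ↔
      ∃ k d, g = dihedralPerm n (.sr k) * f * dihedralPerm n d := by
  constructor
  · rintro ⟨a, h⟩
    have ha : (a : ℂ) ∈ polygon g := by
      rw [← h]
      exact ⟨1, by simpa using toCircle_mem_polygon f 0, by simp [reflection_apply]⟩
    obtain ⟨k, rfl⟩ := exists_eq_toCircle_of_mem_polygon ha
    rw [← neg_neg k, reflection_polygon, polygon_eq_iff hn] at h
    exact ⟨-k, h⟩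
  · rintro ⟨k, d, h⟩
    exact ⟨ZMod.toCircle (-k), by rw [reflection_polygon, polygon_eq_iff hn]; exact ⟨d, h⟩⟩

/-! ### Hamiltonian cycles as closed polygons -/

/-- The vertices of `K n`, labelled by the residues modulo `n`. -/
def label (n : ℕ) [NeZero n] : Fin n ≃ ZMod n where
  toFun k := (k : ℕ)
  invFun x := ⟨x.val, x.val_lt⟩
  left_inv k := Fin.ext (ZMod.val_cast_of_lt k.2)
  right_inv x := ZMod.natCast_zmod_val x

theorem point_eq (k : Fin n) : point n k = ZMod.toCircle (label n k) :=
  (ZMod.toCircle_natCast (N := n) k).symm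

/-- The figure of a closed walk of length `n` is the polygon that visits the vertices in the order
of the walk. -/
theorem figure_toSubgraph {v : Fin n} (w : (K n).Walk v v) (hw : w.length = n)
    (f : Equiv.Perm (ZMod n)) (hf : ∀ i ≤ n, label n (w.getVert i) = f i) :
    figure w.toSubgraph = polygon f := by
  have hside {z : ℂ} {i : ℕ} (hi : i < n)
      (hz : z ∈ segment ℝ (point n (w.getVert i)) (point n (w.getVert (i + 1)))) :
      z ∈ polygon f := by
    refine Set.mem_iUnion.2 ⟨(i : ZMod n), ?_⟩
    rwa [point_eq, point_eq, hf i hi.le, hf (i + 1) hi, Nat.cast_succ] at hz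
  apply Set.Subset.antisymm
  · rintro z (⟨u, -, rfl⟩ | ⟨u, u', hadj, hz⟩)
    · rw [point_eq]
      exact toCircle_mem_polygon f _
    · obtain ⟨i, he, hi⟩ := w.toSubgraph_adj_iff.1 hadj
      rw [hw] at hi
      refine hside hi ?_
      rcases Sym2.eq_iff.1 he with ⟨h1, h2⟩ | ⟨h1, h2⟩
      · rwa [h1, h2]
      · rwa [h1, h2, segment_symm]
  · intro z hz
    obtain ⟨i, hi⟩ := Set.mem_iUnion.1 hz
    refine Or.inr ⟨w.getVert i.val, w.getVert (i.val + 1),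
      w.toSubgraph_adj_getVert (hw.symm ▸ i.val_lt), ?_⟩
    rw [point_eq, point_eq, hf _ i.val_lt.le, hf _ i.val_lt]
    simpa using hi

theorem exists_figure_eq_polygon (G : C n) : ∃ f : Equiv.Perm (ZMod n), polygon f = figure G.1 := by
  obtain ⟨_, v, w, hw, rfl⟩ := G
  have hlen : w.length = n := by simpa using hw.length_eq
  have hinj : Function.Injective fun x : ZMod n => label n (w.getVert x.val) := by
    intro x y h
    have hx := x.val_lt
    have hy := y.val_lt
    exact ZMod.val_injective n (hw.isCycle.getVert_injOn' (by rw [Set.mem_ofPred_eq]; lia)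
      (by rw [Set.mem_ofPred_eq]; lia) ((label n).injective h))
  refine ⟨Equiv.ofBijective _ (Finite.injective_iff_bijective.1 hinj), ?_⟩
  refine (figure_toSubgraph w hlen _ fun i hi => ?_).symm
  rw [Equiv.ofBijective_apply]
  rcases hi.lt_or_eq with hi | hi
  · rw [ZMod.val_cast_of_lt hi]
  · have h0 : (i : ZMod n) = 0 := by rw [hi, ZMod.natCast_self]
    rw [h0, ZMod.val_zero, w.getVert_zero, w.getVert_of_length_le (by omega)]

theorem exists_polygon_eq_figure (hn : 3 ≤ n) (f : Equiv.Perm (ZMod n)) :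
    ∃ G : C n, figure G.1 = polygon f := by
  obtain ⟨m, rfl⟩ := Nat.exists_eq_add_of_le' hn
  -- The standard cycle of the cycle graph passes through the labels in descending order.
  let F : Fin (m + 3) ≃ Fin (m + 3) :=
    ((label (m + 3)).trans ((Equiv.neg _).trans f)).trans (label (m + 3)).symm
  let toK : SimpleGraph.cycleGraph (m + 3) →g K (m + 3) :=
    ⟨F, fun h => (SimpleGraph.top_adj _ _).2 (F.injective.ne h.ne)⟩
  let w := (SimpleGraph.cycleGraph.cycle m).map toK
  have hlen : w.length = m + 3 := by simp [w]
  have hcyc : w.IsHamiltonianCycle := by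
    rw [SimpleGraph.Walk.isHamiltonianCycle_iff_isCycle_and_length_eq]
    exact ⟨SimpleGraph.cycleGraph.isCycle_cycle.map F.injective, by simpa using hlen⟩
  refine ⟨⟨w.toSubgraph, _, w, hcyc, rfl⟩, figure_toSubgraph w hlen f fun i hi => ?_⟩
  rw [SimpleGraph.Walk.getVert_map, SimpleGraph.cycleGraph.getVert_cycle hi]
  change label _ (F _) = _
  simp only [F, Equiv.trans_apply, Equiv.apply_symm_apply]
  congr 1
  change -(((m + 3 - i) % (m + 3) : ℕ) : ZMod (m + 3)) = i
  rw [ZMod.natCast_mod, Nat.cast_sub hi, ZMod.natCast_self, zero_sub, neg_neg]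

end Polygon

end GeomHam

theorem mainTheorem5 (p : ℕ) (hp : p.Prime) (hp2 : 2 < p) :
    (Nat.card (Quotient (GeomHam.relS p)) : ℚ) =
        1 / (4 * (p : ℚ)) *
          (((p : ℚ) - 1) ^ 2 + (p : ℚ) * (((p - 1)‼ : ℕ) : ℚ) + (((p - 1)! : ℕ) : ℚ)) ∧
      (Nat.card (Quotient (GeomHam.relE p)) : ℚ) =
        1 / (2 * (p : ℚ)) * (((p : ℚ) - 1) ^ 2 + (((p - 1)! : ℕ) : ℚ)) := by
  have : Fact p.Prime := ⟨hp⟩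
  obtain ⟨m, hm⟩ := hp.odd_of_ne_two hp2.ne'
  have hm0 : 0 < m := by omega
  choose q hq using GeomHam.exists_polygon_eq_figure (n := p) hp2
  have hS := GeomHam.card_quotient_mul_card_mul_card (GeomHam.dihedralPerm p)
    (GeomHam.dihedralPerm p) (GeomHam.relS p) q
    (fun G => by
      obtain ⟨f, hf⟩ := GeomHam.exists_figure_eq_polygon G
      exact ⟨f, 1, Or.inl (by rw [hq, hf]; simp)⟩)
    (fun f g => by
      change GeomHam.Similar _ _ ↔ _
      rw [GeomHam.Similar, exists_or, hq, hq, GeomHam.exists_rotation_polygon_eq_iff hp2,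
        GeomHam.exists_reflection_polygon_eq_iff hp2]
      constructor
      · rintro (⟨k, d, h⟩ | ⟨k, d, h⟩)
        exacts [⟨_, d, h⟩, ⟨_, d, h⟩]
      · rintro ⟨k | k, d, h⟩
        exacts [Or.inl ⟨k, d, h⟩, Or.inr ⟨k, d, h⟩])
  have hE := GeomHam.card_quotient_mul_card_mul_card
    ((GeomHam.dihedralPerm p).comp (GeomHam.rotationHom p))
    (GeomHam.dihedralPerm p) (GeomHam.relE p) q
    (fun G => by
      obtain ⟨f, hf⟩ := GeomHam.exists_figure_eq_polygon G
      exact ⟨f, 1, by rw [hq, hf]; simp⟩)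
    (fun f g => by
      change GeomHam.Equivalent _ _ ↔ _
      rw [GeomHam.Equivalent, hq, hq, GeomHam.exists_rotation_polygon_eq_iff hp2]
      exact Iff.rfl)
  replace hS := hS.trans (GeomHam.sum_numIntertwiners hm hm0)
  replace hE := hE.trans ((Multiplicative.ofAdd.sum_comp _).symm.trans
    (GeomHam.sum_numIntertwiners_rotation hm hm0))
  rw [DihedralGroup.card] at hS hE
  rw [Fintype.card_multiplicative, ZMod.card] at hE
  have hp0 : (p : ℚ) ≠ 0 := by exact_mod_cast hp.ne_zero
  have hsub : ((p - 1 : ℕ) : ℚ) = p - 1 := by rw [Nat.cast_sub hp.one_le, Nat.cast_one]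
  have hfac : ((p ! : ℕ) : ℚ) = p * ((p - 1)! : ℕ) := by
    rw [← Nat.mul_factorial_pred hp.ne_zero, Nat.cast_mul]
  replace hS := congrArg (Nat.cast (R := ℚ)) hS
  replace hE := congrArg (Nat.cast (R := ℚ)) hE
  push_cast [hsub, hfac] at hS hE
  -- Both sides carry a spare factor `p`, from `p! = p * (p - 1)!` and the group orders.
  constructor
  · rw [div_mul_eq_mul_div, eq_div_iff (by simpa using hp0)]
    exact mul_left_cancel₀ hp0 (by linear_combination hS)
  · rw [div_mul_eq_mul_div, eq_div_iff (by simpa using hp0)]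
    exact mul_left_cancel₀ hp0 (by linear_combination hE)
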